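/- Let $\rho_0,\rho_1$ be probability densities on $\mathbb{R}^d$ (we write $\rho_0,\rho_1$ also for the corresponding measures) and let $c:\mathbb{R}^d\times\mathbb{R}^d\to[0,\infty)$ be continuous with $c(x,y)=0$ if and only if $x=y$. Assume that for some $p\ge 1$ and some $A,B>0$ one has $c(x,y)\le A+B(|x|^p+|y|^p)$ for all $(x,y)$ outside some compact set, and that $\rho_0$ and $\rho_1$ have finite $p$-th moments. Fix $\epsilon>0$. Let $\mu_\epsilon$ be the static Schrödinger bridge connecting $\rho_0$ to $\rho_1$ at temperature $\epsilon$, i.e. the probability measure $$\mu_\epsilon(dx\,dy)=\exp\Big(-\tfrac1\epsilon\big(c(x,y)-a_\epsilon(x)-b_\epsilon(y)\big)\Big)\,\rho_0(dx)\,\rho_1(dy)$$ with marginals $\rho_0$ and $\rho_1$, where $a_\epsilon,b_\epsilon:\mathbb{R}^d\to\mathbb{R}$ are measurable (the Schrödinger potentials), and assume $a_\epsilon\in L^1(\rho_0)$ and $b_\epsilon\in L^1(\rho_1)$. Given data $(X_i,Y_i)_{i\ge1}$ in $\mathbb{R}^d\times\mathbb{R}^d$ and $N\ge 1$, define the discrete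 Schrödinger bridge by $$\hat\mu^N_\epsilon=\sum_{\sigma\in\mathcal S_N}q^*_\epsilon(\sigma)\,\frac1N\sum_{i=1}^N\delta_{(X_i,Y_{\sigma_i})},\qquad q^*_\epsilon(\sigma)=\frac{\exp\big(-\frac1\epsilon\sum_{i=1}^N c(X_i,Y_{\sigma_i})\big)}{\sum_{\tau\in\mathcal S_N}\exp\big(-\frac1\epsilon\sum_{i=1}^N c(X_i,Y_{\tau_i})\big)},$$ where $\mathcal S_N$ is the set of permutations of $\{1,\dots,N\}$. Let $Q^\infty=\bigotimes_{i\ge1}\mu_\epsilon$ and $P^\infty=\bigotimes_{i\ge1}(\rho_0\otimes\rho_1)$ be the laws of the data sequence when the pairs $(X_i,Y_i)$ are i.i.d. from $\mu_\epsilon$, respectively from $\rho_0\otimes\rho_1$. Then, as $N\to\infty$: 1. $\hat\mu^N_\epsilon$ converges weakly to $\mu_\epsilon$, $Q^\infty$-almost surely; 2. $\hat\mu^N_\epsilon$ converges weakly to $\mu_\epsilon$ in $P^\infty$-probability, i.e. $P^\infty(\hat\mu^N_\epsilon\notin U)\to0$ for every neighbourhood $U$ of $\mu_\epsilon$ in the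 topology of weak convergence of probability measures on $\mathbb{R}^d\times\mathbb{R}^d$. -/

import Mathlib

open MeasureTheory Filter Topology

noncomputable section

namespace SchrodingerBridge

/-- The total cost `c(x, y_σ) = ∑ i, c (x i) (y (σ i))` of the matching `i ↦ σ i`. -/
def matchingCost {E : Type*} (c : E → E → ℝ) {N : ℕ} (x y : Fin N → E)
    (σ : Equiv.Perm (Fin N)) : ℝ :=
  ∑ i, c (x i) (y (σ i))

/-- The Gibbs probability `q*_ε(σ)` on the permutations of `N` labels. -/
def gibbsWeight {E : Type*} (c : E → E → ℝ) (ε : ℝ) {N : ℕ} (x y : Fin N → E)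
    (σ : Equiv.Perm (Fin N)) : ℝ :=
  Real.exp (-(1 / ε) * matchingCost c x y σ) /
    ∑ τ : Equiv.Perm (Fin N), Real.exp (-(1 / ε) * matchingCost c x y τ)

/-- The discrete Schrödinger bridge
`∑ σ, q*_ε(σ) (1 / N) ∑ i, δ_{(x i, y (σ i))}` of the data `x`, `y`, as a measure. -/
def discreteBridgeMeasure {E : Type*} [MeasurableSpace E] (c : E → E → ℝ) (ε : ℝ) {N : ℕ}
    (x y : Fin N → E) : Measure (E × E) :=
  ∑ σ : Equiv.Perm (Fin N), ENNReal.ofReal (gibbsWeight c ε x y σ) •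
    ((N : ENNReal)⁻¹ • ∑ i, Measure.dirac (x i, y (σ i)))

theorem sum_gibbsWeight {E : Type*} (c : E → E → ℝ) (ε : ℝ) {N : ℕ} (x y : Fin N → E) :
    ∑ σ, gibbsWeight c ε x y σ = 1 := by
  unfold gibbsWeight
  rw [← Finset.sum_div]
  exact div_self (Finset.sum_pos (fun _ _ => Real.exp_pos _) Finset.univ_nonempty).ne'

theorem gibbsWeight_nonneg {E : Type*} (c : E → E → ℝ) (ε : ℝ) {N : ℕ} (x y : Fin N → E)
    (σ : Equiv.Perm (Fin N)) : 0 ≤ gibbsWeight c ε x y σ :=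
  div_nonneg (Real.exp_pos _).le (Finset.sum_nonneg fun _ _ => (Real.exp_pos _).le)

theorem isProbabilityMeasure_discreteBridgeMeasure {E : Type*} [MeasurableSpace E]
    (c : E → E → ℝ) (ε : ℝ) {N : ℕ} [NeZero N] (x y : Fin N → E) :
    IsProbabilityMeasure (discreteBridgeMeasure c ε x y) := by
  constructor
  have hN : (N : ENNReal) ≠ 0 := by exact_mod_cast NeZero.ne N
  have h1 : (N : ENNReal)⁻¹ * (N : ENNReal) = 1 :=
    ENNReal.inv_mul_cancel hN (ENNReal.natCast_ne_top N)
  simp only [discreteBridgeMeasure, Measure.coe_finsetSum, Measure.coe_smul, Finset.sum_apply,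
    Pi.smul_apply, smul_eq_mul, measure_univ, Finset.sum_const, Finset.card_univ,
    Fintype.card_fin, nsmul_eq_mul, mul_one, h1]
  rw [← ENNReal.ofReal_sum_of_nonneg (fun σ _ => gibbsWeight_nonneg c ε x y σ),
    sum_gibbsWeight, ENNReal.ofReal_one]

/-- The discrete Schrödinger bridge of `N ≥ 1` pairs of data points, as a probability measure. -/
def discreteBridge {E : Type*} [MeasurableSpace E] (c : E → E → ℝ) (ε : ℝ) {N : ℕ} [NeZero N]
    (x y : Fin N → E) : ProbabilityMeasure (E × E) :=
  ⟨discreteBridgeMeasure c ε x y, isProbabilityMeasure_discreteBridgeMeasure c ε x y⟩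

/-- The random measure `μ̂^N_ε`: the discrete Schrödinger bridge of the first `N ≥ 1` terms
`(X_i, Y_i) = ω i` of the sequence of data `ω`. -/
def empiricalBridge {E : Type*} [MeasurableSpace E] (c : E → E → ℝ) (ε : ℝ) (N : ℕ) [NeZero N]
    (ω : ℕ → E × E) : ProbabilityMeasure (E × E) :=
  discreteBridge c ε (fun i : Fin N => (ω i).1) (fun i : Fin N => (ω i).2)

/-- `μ` is the static Schrödinger bridge connecting `ρ₀` to `ρ₁` at temperature `ε`, for the
cost `c`, with Schrödinger potentials `a` and `b`: it is a coupling of `ρ₀` and `ρ₁` with density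
`ξ (x, y) = exp (-(1 / ε) (c x y - a x - b y))` with respect to `ρ₀ ⊗ ρ₁`. -/
structure IsSchrodingerBridge {E : Type*} [MeasurableSpace E] (c : E → E → ℝ) (ε : ℝ)
    (ρ₀ ρ₁ : Measure E) (a b : E → ℝ) (μ : Measure (E × E)) : Prop where
  measurable_left : Measurable a
  measurable_right : Measurable b
  eq_withDensity : μ = (ρ₀.prod ρ₁).withDensity
    (fun z => ENNReal.ofReal (Real.exp (-(1 / ε) * (c z.1 z.2 - a z.1 - b z.2))))
  fst_eq : μ.fst = ρ₀
  snd_eq : μ.snd = ρ₁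

end SchrodingerBridge

end

/-! Draw a permutation `σ` from the Gibbs weights; the discrete bridge is the mean of the random
empirical measure `π_σ` of the matched pairs. It suffices that the empirical marginals of the data
converge: then `π_σ` concentrates at `μ`, whatever the dependence within the pairs. By Varadarajan's
theorem (`ae_tendsto_empiricalMeasure`) this applies almost surely to data drawn from any coupling
of `ρ₀` and `ρ₁`, so to both sampling laws, and convergence in probability under the product law
follows from almost sure convergence.

Concentration rests on detailed balance: exchanging the partners of `i` and `j` changes the Gibbs
weight by an explicit factor. If `c ≤ u + v`, the weight `k = exp ((c - u - v) / ε)` is at most `1`,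
and the exchange symmetry makes the covariance of `f(x)` and `g(y)` under `k π_σ` of order `1 / N`
in mean square (`sum_gibbsWeight_mul_matchingCov_sq_le`). Every possible limit `ν` thus has
marginals `ρ₀`, `ρ₁` and a product measure `k ν`, so its density has the form `exp (-c / ε + φ(x) +
ψ(y))` (`exists_eq_withDensity_of_integral_mul_eq`). Only one coupling has such a density
(`eq_of_withDensity_exp_add`), so `ν = μ`. The matching measures lie in a compact set because their
marginals are tight, and `tendsto_sum_mul_of_forall_ne` turns uniqueness of the limit into
convergence. -/

open scoped BoundedContinuousFunction

noncomputable section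

namespace SchrodingerBridge

/-! ### Exchange symmetry of the Gibbs weights and the covariance estimate -/

section Exchange

variable {E : Type*} {N : ℕ}

/-- Exchanging the partners of `i` and `j` only changes the corresponding two terms of a sum
over the pairs of a matching. -/
theorem sum_mul_swap_sub (F : E → E → ℝ) (x y : Fin N → E) (σ : Equiv.Perm (Fin N))
    {i j : Fin N} (hij : i ≠ j) :
    ∑ l, F (x l) (y ((σ * Equiv.swap i j) l)) - ∑ l, F (x l) (y (σ l)) =
      F (x i) (y (σ j)) + F (x j) (y (σ i)) - (F (x i) (y (σ i)) + F (x j) (y (σ j))) := by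
  rw [← Finset.sum_sub_distrib, ← Finset.sum_subset (Finset.subset_univ {i, j}),
    Finset.sum_pair hij]
  · simp only [Equiv.Perm.mul_apply, Equiv.swap_apply_left, Equiv.swap_apply_right]
    ring
  · intro l _ hl
    simp only [Finset.mem_insert, Finset.mem_singleton, not_or] at hl
    simp [Equiv.Perm.mul_apply, Equiv.swap_apply_of_ne_of_ne hl.1 hl.2]

theorem abs_sum_mul_swap_sub_le {F : E → E → ℝ} {B : ℝ} (hF : ∀ x y, |F x y| ≤ B)
    (x y : Fin N → E) (σ : Equiv.Perm (Fin N)) (i j : Fin N) :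
    |∑ l, F (x l) (y ((σ * Equiv.swap i j) l)) - ∑ l, F (x l) (y (σ l))| ≤ 4 * B := by
  rcases eq_or_ne i j with rfl | hij
  · have hB : 0 ≤ B := (abs_nonneg _).trans (hF (x i) (x i))
    simpa using hB
  · rw [sum_mul_swap_sub F x y σ hij]
    have h1 := abs_le.1 (hF (x i) (y (σ j)))
    have h2 := abs_le.1 (hF (x j) (y (σ i)))
    have h3 := abs_le.1 (hF (x i) (y (σ i)))
    have h4 := abs_le.1 (hF (x j) (y (σ j)))
    rw [abs_le]
    constructor <;> linarith [h1.1, h1.2, h2.1, h2.2, h3.1, h3.2, h4.1, h4.2]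

/-- Detailed balance of the Gibbs weights under the exchange of two partners. -/
theorem gibbsWeight_mul_swap (c : E → E → ℝ) (ε : ℝ) (u v : E → ℝ) (x y : Fin N → E)
    (σ : Equiv.Perm (Fin N)) {i j : Fin N} (hij : i ≠ j) :
    gibbsWeight c ε x y (σ * Equiv.swap i j) *
        (Real.exp ((c (x i) (y (σ j)) - u (x i) - v (y (σ j))) / ε) *
          Real.exp ((c (x j) (y (σ i)) - u (x j) - v (y (σ i))) / ε)) =
      gibbsWeight c ε x y σ *
        (Real.exp ((c (x i) (y (σ i)) - u (x i) - v (y (σ i))) / ε) *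
          Real.exp ((c (x j) (y (σ j)) - u (x j) - v (y (σ j))) / ε)) := by
  have h := sum_mul_swap_sub c x y σ hij
  unfold gibbsWeight matchingCost
  rw [div_mul_eq_mul_div, div_mul_eq_mul_div, ← Real.exp_add, ← Real.exp_add, ← Real.exp_add,
    ← Real.exp_add]
  rw [sub_eq_iff_eq_add] at h
  rw [h]
  -- Both sides contain the same values of `u` and `v`, which cancel; only the costs are traded.
  congr 2
  ring

/-- The sum of `F` over the pairs of a matching. -/
def matchingSum (F : E → E → ℝ) (x y : Fin N → E) (σ : Equiv.Perm (Fin N)) : ℝ :=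
  ∑ i, F (x i) (y (σ i))

theorem abs_matchingSum_le {F : E → E → ℝ} {B : ℝ} (hF : ∀ x y, |F x y| ≤ B)
    (x y : Fin N → E) (σ : Equiv.Perm (Fin N)) : |matchingSum F x y σ| ≤ N * B := by
  refine (Finset.abs_sum_le_sum_abs _ _).trans ?_
  refine (Finset.sum_le_sum fun i _ => hF _ _).trans ?_
  simp

/-- The (unnormalized) covariance of `f` and `g` over the pairs of a matching weighted by `k`. -/
def matchingCov (k : E → E → ℝ) (f g : E → ℝ) (x y : Fin N → E) (σ : Equiv.Perm (Fin N)) : ℝ :=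
  matchingSum (fun s t => k s t * (f s * g t)) x y σ * matchingSum k x y σ -
    matchingSum (fun s t => k s t * f s) x y σ * matchingSum (fun s t => k s t * g t) x y σ

theorem matchingCov_eq_sum (k : E → E → ℝ) (f g : E → ℝ) (x y : Fin N → E)
    (σ : Equiv.Perm (Fin N)) :
    matchingCov k f g x y σ = ∑ i, ∑ j, k (x i) (y (σ i)) * k (x j) (y (σ j)) *
      (f (x i) * (g (y (σ i)) - g (y (σ j)))) := by
  unfold matchingCov matchingSum
  rw [Finset.sum_mul_sum, Finset.sum_mul_sum, ← Finset.sum_sub_distrib]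
  refine Finset.sum_congr rfl fun i _ => ?_
  rw [← Finset.sum_sub_distrib]
  exact Finset.sum_congr rfl fun j _ => by ring

/-- Each of the four sums is at most `N * B` and moves by at most `4 * B` under an exchange, so each
of the two products moves by at most `8 * B ^ 2 * N`. -/
theorem abs_matchingCov_swap_sub_le {k : E → E → ℝ} {f g : E → ℝ} {B : ℝ}
    (h0 : ∀ s t, |k s t| ≤ B) (hf : ∀ s t, |k s t * f s| ≤ B) (hg : ∀ s t, |k s t * g t| ≤ B)
    (hfg : ∀ s t, |k s t * (f s * g t)| ≤ B) (x y : Fin N → E) (σ : Equiv.Perm (Fin N))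
    (i j : Fin N) :
    |matchingCov k f g x y (σ * Equiv.swap i j) - matchingCov k f g x y σ| ≤
      16 * B ^ 2 * N := by
  have key : ∀ a b a' b' : ℝ, |a' - a| ≤ 4 * B → |b' - b| ≤ 4 * B → |a'| ≤ N * B → |b| ≤ N * B →
      |a' * b' - a * b| ≤ 8 * B ^ 2 * N := by
    intro a b a' b' ha hb ha' hb'
    have hB : 0 ≤ B := by linarith [abs_nonneg (a' - a)]
    calc |a' * b' - a * b| = |a' * (b' - b) + (a' - a) * b| := by ring_nf
      _ ≤ |a'| * |b' - b| + |a' - a| * |b| := by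
        rw [← abs_mul, ← abs_mul]; exact abs_add_le _ _
      _ ≤ (N * B) * (4 * B) + (4 * B) * (N * B) := by gcongr
      _ = 8 * B ^ 2 * N := by ring
  have h1 := key _ _ _ _ (abs_sum_mul_swap_sub_le hfg x y σ i j)
    (abs_sum_mul_swap_sub_le h0 x y σ i j) (abs_matchingSum_le hfg x y _)
    (abs_matchingSum_le h0 x y _)
  have h2 := key _ _ _ _ (abs_sum_mul_swap_sub_le hf x y σ i j)
    (abs_sum_mul_swap_sub_le hg x y σ i j) (abs_matchingSum_le hf x y _)
    (abs_matchingSum_le hg x y _)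
  have h3 : matchingCov k f g x y (σ * Equiv.swap i j) - matchingCov k f g x y σ =
      ((∑ l, k (x l) (y ((σ * Equiv.swap i j) l)) *
            (f (x l) * g (y ((σ * Equiv.swap i j) l)))) *
          (∑ l, k (x l) (y ((σ * Equiv.swap i j) l))) -
        (∑ l, k (x l) (y (σ l)) * (f (x l) * g (y (σ l)))) * ∑ l, k (x l) (y (σ l))) -
      ((∑ l, k (x l) (y ((σ * Equiv.swap i j) l)) * f (x l)) *
          (∑ l, k (x l) (y ((σ * Equiv.swap i j) l)) * g (y ((σ * Equiv.swap i j) l))) -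
        (∑ l, k (x l) (y (σ l)) * f (x l)) * ∑ l, k (x l) (y (σ l)) * g (y (σ l))) := by
    unfold matchingCov matchingSum
    ring
  rw [h3]
  refine (abs_sub _ _).trans ?_
  linarith

/-- Under the Gibbs weights, the weighted covariance of a matching is small in mean square. -/
theorem sum_gibbsWeight_mul_matchingCov_sq_le (c : E → E → ℝ) (ε : ℝ) (u v : E → ℝ)
    {f g : E → ℝ} {B : ℝ} {k : E → E → ℝ}
    (hk : ∀ s t, k s t = Real.exp ((c s t - u s - v t) / ε))
    (h0 : ∀ s t, |k s t| ≤ B) (hf : ∀ s t, |k s t * f s| ≤ B) (hg : ∀ s t, |k s t * g t| ≤ B)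
    (hfg : ∀ s t, |k s t * (f s * g t)| ≤ B) (x y : Fin N → E) :
    ∑ σ, gibbsWeight c ε x y σ * matchingCov k f g x y σ ^ 2 ≤ 16 * B ^ 4 * N ^ 3 := by
  set q := gibbsWeight c ε x y with hq
  set D := matchingCov k f g x y with hD
  set T : Fin N → Fin N → Equiv.Perm (Fin N) → ℝ := fun i j σ =>
    k (x i) (y (σ i)) * k (x j) (y (σ j)) * (f (x i) * (g (y (σ i)) - g (y (σ j)))) with hT
  have hTle : ∀ i j σ, |T i j σ| ≤ 2 * B ^ 2 := by
    intro i j σ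
    have h1 := hfg (x i) (y (σ i))
    have h2 := h0 (x j) (y (σ j))
    have h3 := hf (x i) (y (σ i))
    have h4 := hg (x j) (y (σ j))
    have hB : 0 ≤ B := (abs_nonneg _).trans h2
    calc |T i j σ| = |k (x i) (y (σ i)) * (f (x i) * g (y (σ i))) * k (x j) (y (σ j)) -
          k (x i) (y (σ i)) * f (x i) * (k (x j) (y (σ j)) * g (y (σ j)))| := by
            simp only [hT]; congr 1; ring
      _ ≤ B * B + B * B := by
        refine (abs_sub _ _).trans ?_
        rw [abs_mul, abs_mul (k (x i) (y (σ i)) * f (x i))]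
        gcongr
      _ = 2 * B ^ 2 := by ring
  have hpair : ∀ i j, ∑ σ, q σ * (T i j σ * D σ) ≤ 16 * B ^ 4 * N := by
    intro i j
    -- By detailed balance `q` times the two weights `k` is unchanged by the exchange, while the
    -- difference of the values of `g` changes sign.
    have hanti : ∀ σ, q (σ * Equiv.swap i j) * T i j (σ * Equiv.swap i j) = -(q σ * T i j σ) := by
      intro σ
      rcases eq_or_ne i j with rfl | hij
      · simp [hT]
      · have := gibbsWeight_mul_swap c ε u v x y σ hij
        rw [← hq] at this
        simp only [hT, Equiv.Perm.mul_apply, Equiv.swap_apply_left, Equiv.swap_apply_right, hk]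
        linear_combination (f (x i) * (g (y (σ j)) - g (y (σ i)))) * this
    have hre : ∑ σ, q σ * (T i j σ * D σ) =
        ∑ σ, -(q σ * T i j σ) * D (σ * Equiv.swap i j) := by
      rw [← Equiv.sum_comp (Equiv.mulRight (Equiv.swap i j))]
      refine Finset.sum_congr rfl fun σ _ => ?_
      rw [Equiv.coe_mulRight, ← mul_assoc, hanti]
    -- Averaging the sum with its exchanged form replaces `D` by its increment, which is smaller
    -- than `D` by a factor of order `N`.
    have hdouble : 2 * ∑ σ, q σ * (T i j σ * D σ) ≤ 32 * B ^ 4 * N := by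
      calc 2 * ∑ σ, q σ * (T i j σ * D σ)
          = ∑ σ, q σ * (T i j σ * -(D (σ * Equiv.swap i j) - D σ)) := by
            rw [two_mul]
            nth_rewrite 2 [hre]
            rw [← Finset.sum_add_distrib]
            exact Finset.sum_congr rfl fun σ _ => by ring
        _ ≤ ∑ σ, q σ * (32 * B ^ 4 * N) := by
            refine Finset.sum_le_sum fun σ _ => ?_
            refine mul_le_mul_of_nonneg_left ?_ (gibbsWeight_nonneg c ε x y σ)
            refine (le_abs_self _).trans ?_
            rw [abs_mul, abs_neg]
            calc |T i j σ| * |D (σ * Equiv.swap i j) - D σ|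
                ≤ (2 * B ^ 2) * (16 * B ^ 2 * N) :=
                  mul_le_mul (hTle i j σ) (abs_matchingCov_swap_sub_le h0 hf hg hfg x y σ i j)
                    (abs_nonneg _) (by positivity)
              _ = 32 * B ^ 4 * N := by ring
        _ = 32 * B ^ 4 * N := by
            rw [← Finset.sum_mul, hq, sum_gibbsWeight, one_mul]
    linarith
  calc ∑ σ, q σ * D σ ^ 2 = ∑ σ, ∑ i, ∑ j, q σ * (T i j σ * D σ) := by
        refine Finset.sum_congr rfl fun σ _ => ?_
        have : D σ = ∑ i, ∑ j, T i j σ := matchingCov_eq_sum k f g x y σ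
        simp_rw [← Finset.mul_sum, ← Finset.sum_mul, ← this]
        ring
    _ = ∑ i, ∑ j, ∑ σ, q σ * (T i j σ * D σ) := by
        rw [Finset.sum_comm]
        exact Finset.sum_congr rfl fun i _ => Finset.sum_comm
    _ ≤ ∑ _i : Fin N, ∑ _j : Fin N, 16 * B ^ 4 * N :=
        Finset.sum_le_sum fun i _ => Finset.sum_le_sum fun j _ => hpair i j
    _ = 16 * B ^ 4 * N ^ 3 := by
        simp only [Finset.sum_const, Finset.card_univ, Fintype.card_fin, nsmul_eq_mul]
        ring

end Exchange

/-! ### A coupling is determined by its marginals and its density modulo one-variable factors -/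

section Uniqueness

variable {X Y : Type*} [MeasurableSpace X] [MeasurableSpace Y]

theorem exists_eq_withDensity_exp {α ρ : Measure X} [SigmaFinite α] [SigmaFinite ρ]
    (h : α ≪ ρ) (h' : ρ ≪ α) :
    ∃ φ : X → ℝ, Measurable φ ∧ α = ρ.withDensity (fun x => ENNReal.ofReal (Real.exp (φ x))) := by
  refine ⟨fun x => Real.log (α.rnDeriv ρ x).toReal, by fun_prop, ?_⟩
  conv_lhs => rw [← Measure.withDensity_rnDeriv_eq α ρ h]
  refine withDensity_congr_ae ?_
  filter_upwards [h'.ae_le (Measure.rnDeriv_pos h), Measure.rnDeriv_ne_top α ρ] with x h1 h2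
  rw [Real.exp_log (ENNReal.toReal_pos h1.ne' h2), ENNReal.ofReal_toReal h2]

/-- Since `arctan` is odd and increasing, `arctan f + arctan g` has the sign of `f + g`. It is a
bounded substitute for the log-ratio `f + g` of two densities, which need not be integrable. -/
theorem arctan_add_arctan_mul_exp_sub_nonneg (f g s t : ℝ) (h : s - t = f + g) :
    0 ≤ (Real.exp s - Real.exp t) * (Real.arctan f + Real.arctan g) := by
  rcases le_total 0 (f + g) with hfg | hfg
  · refine mul_nonneg (sub_nonneg.2 (Real.exp_le_exp.2 (by linarith))) ?_
    have := Real.arctan_strictMono.monotone (show -g ≤ f by linarith)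
    rw [Real.arctan_neg] at this
    linarith
  · refine mul_nonneg_of_nonpos_of_nonpos (sub_nonpos.2 (Real.exp_le_exp.2 (by linarith))) ?_
    have := Real.arctan_strictMono.monotone (show f ≤ -g by linarith)
    rw [Real.arctan_neg] at this
    linarith

theorem eq_of_arctan_add_arctan_mul_exp_sub_eq_zero (f g s t : ℝ) (h : s - t = f + g)
    (h0 : (Real.exp s - Real.exp t) * (Real.arctan f + Real.arctan g) = 0) : s = t := by
  rcases mul_eq_zero.1 h0 with h1 | h1
  · exact Real.exp_injective (sub_eq_zero.1 h1)
  · have : Real.arctan f = Real.arctan (-g) := by rw [Real.arctan_neg]; linarith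
    have := Real.arctan_injective this
    linarith

/-- A coupling is determined by its marginals and its density, up to factors depending on one
coordinate only. -/
theorem eq_of_withDensity_exp_add {ρ π₁ π₂ : Measure (X × Y)}
    [IsProbabilityMeasure π₁] [IsProbabilityMeasure π₂] {h : X × Y → ℝ} {φ₁ φ₂ : X → ℝ}
    {ψ₁ ψ₂ : Y → ℝ} (hh : Measurable h) (hφ₁ : Measurable φ₁) (hφ₂ : Measurable φ₂)
    (hψ₁ : Measurable ψ₁) (hψ₂ : Measurable ψ₂)
    (h₁ : π₁ = ρ.withDensity (fun z => ENNReal.ofReal (Real.exp (h z + φ₁ z.1 + ψ₁ z.2))))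
    (h₂ : π₂ = ρ.withDensity (fun z => ENNReal.ofReal (Real.exp (h z + φ₂ z.1 + ψ₂ z.2))))
    (hfst : π₁.fst = π₂.fst) (hsnd : π₁.snd = π₂.snd) : π₁ = π₂ := by
  set f : X → ℝ := fun x => φ₁ x - φ₂ x with hf
  set g : Y → ℝ := fun y => ψ₁ y - ψ₂ y with hg
  have mf : Measurable fun x => Real.arctan (f x) := Real.measurable_arctan.comp (hφ₁.sub hφ₂)
  have mg : Measurable fun y => Real.arctan (g y) := Real.measurable_arctan.comp (hψ₁.sub hψ₂)
  have bd : ∀ r : ℝ, ‖Real.arctan r‖ ≤ Real.pi / 2 := fun r =>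
    abs_le.2 ⟨(Real.neg_pi_div_two_lt_arctan r).le, (Real.arctan_lt_pi_div_two r).le⟩
  have int1 : ∀ (π : Measure (X × Y)) [IsProbabilityMeasure π],
      Integrable (fun z : X × Y => Real.arctan (f z.1)) π := fun π _ =>
    Integrable.of_bound (mf.comp measurable_fst).aestronglyMeasurable (Real.pi / 2)
      (ae_of_all _ fun z => bd _)
  have int2 : ∀ (π : Measure (X × Y)) [IsProbabilityMeasure π],
      Integrable (fun z : X × Y => Real.arctan (g z.2)) π := fun π _ =>
    Integrable.of_bound (mg.comp measurable_snd).aestronglyMeasurable (Real.pi / 2)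
      (ae_of_all _ fun z => bd _)
  have marg : ∀ (π : Measure (X × Y)) [IsProbabilityMeasure π],
      ∫ z, (Real.arctan (f z.1) + Real.arctan (g z.2)) ∂π =
        ∫ x, Real.arctan (f x) ∂π.fst + ∫ y, Real.arctan (g y) ∂π.snd := by
    intro π _
    rw [integral_add (int1 π) (int2 π), Measure.fst, Measure.snd,
      integral_map measurable_fst.aemeasurable mf.aestronglyMeasurable,
      integral_map measurable_snd.aemeasurable mg.aestronglyMeasurable]
  -- The test function is a sum of one-variable functions, so its integral depends on the marginals
  -- only.
  have heq : ∫ z, (Real.arctan (f z.1) + Real.arctan (g z.2)) ∂π₁ =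
      ∫ z, (Real.arctan (f z.1) + Real.arctan (g z.2)) ∂π₂ := by
    rw [marg, marg, hfst, hsnd]
  have trans : ∀ (π : Measure (X × Y)) [IsProbabilityMeasure π] (H : X × Y → ℝ), Measurable H →
      π = ρ.withDensity (fun z => ENNReal.ofReal (Real.exp (H z))) →
      Integrable (fun z => Real.exp (H z) * (Real.arctan (f z.1) + Real.arctan (g z.2))) ρ ∧
      ∫ z, (Real.arctan (f z.1) + Real.arctan (g z.2)) ∂π =
        ∫ z, Real.exp (H z) * (Real.arctan (f z.1) + Real.arctan (g z.2)) ∂ρ := by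
    intro π _ H hH hπ
    have hm : Measurable fun z => ENNReal.ofReal (Real.exp (H z)) := by fun_prop
    have hfin : ∀ᵐ z ∂ρ, ENNReal.ofReal (Real.exp (H z)) < ⊤ :=
      ae_of_all _ fun z => ENNReal.ofReal_lt_top
    have hI := (int1 π).add (int2 π)
    rw [hπ, integrable_withDensity_iff_integrable_smul' hm hfin] at hI
    refine ⟨?_, ?_⟩
    · refine hI.congr (ae_of_all _ fun z => ?_)
      simp [ENNReal.toReal_ofReal (Real.exp_pos _).le]
    · rw [hπ, integral_withDensity_eq_integral_toReal_smul hm hfin]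
      refine integral_congr_ae (ae_of_all _ fun z => ?_)
      simp [ENNReal.toReal_ofReal (Real.exp_pos _).le]
  obtain ⟨I1, e1⟩ := trans π₁ _ (by fun_prop) h₁
  obtain ⟨I2, e2⟩ := trans π₂ _ (by fun_prop) h₂
  have hzero : ∫ z, (Real.exp (h z + φ₁ z.1 + ψ₁ z.2) - Real.exp (h z + φ₂ z.1 + ψ₂ z.2)) *
      (Real.arctan (f z.1) + Real.arctan (g z.2)) ∂ρ = 0 := by
    simp_rw [sub_mul]
    rw [integral_sub I1 I2, ← e1, ← e2, heq, sub_self]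
  have hsub : ∀ z : X × Y, (h z + φ₁ z.1 + ψ₁ z.2) - (h z + φ₂ z.1 + ψ₂ z.2) =
      f z.1 + g z.2 := fun z => by simp only [hf, hg]; ring
  rw [integral_eq_zero_iff_of_nonneg
    (fun z => arctan_add_arctan_mul_exp_sub_nonneg _ _ _ _ (hsub z))
    (by simp_rw [sub_mul]; exact I1.sub I2)] at hzero
  rw [h₁, h₂]
  refine withDensity_congr_ae ?_
  filter_upwards [hzero] with z hz
  rw [eq_of_arctan_add_arctan_mul_exp_sub_eq_zero _ _ _ _ (hsub z) hz]

end Uniqueness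

/-! ### From factorization on test functions to the form of the density -/

section Factorization

variable {E : Type*} [TopologicalSpace E] [SecondCountableTopology E] [MeasurableSpace E]
  [BorelSpace E] [HasOuterApproxClosed E]

/-- If, after weighting by `exp (-h)`, a coupling behaves on bounded continuous functions as a
product measure, then it has density `exp (h x y + φ x + ψ y)` with respect to the product of
its marginals. -/
theorem exists_eq_withDensity_of_integral_mul_eq (π : Measure (E × E)) [IsProbabilityMeasure π]
    {h : E × E → ℝ} (hh : Continuous h) (h0 : ∀ z, 0 ≤ h z)
    (H : ∀ f g : E →ᵇ ℝ,
      (∫ z, Real.exp (-h z) * (f z.1 * g z.2) ∂π) * (∫ z, Real.exp (-h z) ∂π) =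
        (∫ z, Real.exp (-h z) * f z.1 ∂π) * (∫ z, Real.exp (-h z) * g z.2 ∂π)) :
    ∃ φ ψ : E → ℝ, Measurable φ ∧ Measurable ψ ∧ π = (π.fst.prod π.snd).withDensity
      (fun z => ENNReal.ofReal (Real.exp (h z + φ z.1 + ψ z.2))) := by
  have hhm : Measurable h := hh.measurable
  set w : E × E → ENNReal := fun z => ENNReal.ofReal (Real.exp (-h z)) with hw
  have hwm : Measurable w := by fun_prop
  have hw0 : ∀ z, w z ≠ 0 := fun z => by simp [hw, Real.exp_pos]
  have hwtop : ∀ z, w z < ⊤ := fun z => ENNReal.ofReal_lt_top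
  set θ : Measure (E × E) := π.withDensity w with hθ
  have : IsFiniteMeasure θ := by
    refine isFiniteMeasure_withDensity_ofReal ?_
    refine (Integrable.of_bound (by fun_prop) 1 (ae_of_all _ fun z => ?_)).hasFiniteIntegral
    rw [Real.norm_eq_abs, abs_of_pos (Real.exp_pos _)]
    exact Real.exp_le_one_iff.2 (neg_nonpos.2 (h0 z))
  have hθπ : θ ≪ π := withDensity_absolutelyContinuous _ _
  have hπθ : π ≪ θ := withDensity_absolutelyContinuous' hwm.aemeasurable (ae_of_all _ hw0)
  have hint : ∀ F : E × E → ℝ, ∫ z, F z ∂θ = ∫ z, Real.exp (-h z) * F z ∂π := by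
    intro F
    rw [hθ, integral_withDensity_eq_integral_toReal_smul hwm (ae_of_all _ hwtop)]
    refine integral_congr_ae (ae_of_all _ fun z => ?_)
    simp [hw, ENNReal.toReal_ofReal (Real.exp_pos _).le]
  have hθ0 : θ ≠ 0 := by
    intro hθ0
    have := hπθ (show θ Set.univ = 0 by simp [hθ0])
    simp at this
  set m : ℝ := θ.real Set.univ with hm
  have hmpos : 0 < m := by
    rw [hm, measureReal_def]
    exact ENNReal.toReal_pos (by simpa using hθ0) (measure_ne_top _ _)
  have hmint : ∫ z, Real.exp (-h z) ∂π = m := by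
    have := hint (fun _ => 1)
    simpa using this.symm
  -- `θ` has mass `m` and the product of its marginals has mass `m ^ 2`, hence the factor `m`.
  have hprod : ENNReal.ofReal m • θ = θ.fst.prod θ.snd := by
    have : IsFiniteMeasure (ENNReal.ofReal m • θ) := Measure.smul_finite _ ENNReal.ofReal_ne_top
    refine Measure.eq_prod_of_integral_mul_boundedContinuousFunction fun f g => ?_
    rw [integral_smul_measure, Measure.fst, Measure.snd,
      integral_map measurable_fst.aemeasurable f.continuous.aestronglyMeasurable,
      integral_map measurable_snd.aemeasurable g.continuous.aestronglyMeasurable,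
      hint, hint, hint, ← H, hmint, ENNReal.toReal_ofReal hmpos.le, smul_eq_mul, mul_comm]
  obtain ⟨φ, hφ, eφ⟩ := exists_eq_withDensity_exp (α := θ.fst) (ρ := π.fst)
    (hθπ.map measurable_fst) (hπθ.map measurable_fst)
  obtain ⟨ψ, hψ, eψ⟩ := exists_eq_withDensity_exp (α := θ.snd) (ρ := π.snd)
    (hθπ.map measurable_snd) (hπθ.map measurable_snd)
  -- The term `- log m` accounts for this normalization.
  refine ⟨fun x => φ x - Real.log m, ψ, hφ.sub_const _, hψ, ?_⟩
  have hθprod : θ = ENNReal.ofReal m⁻¹ • (π.fst.prod π.snd).withDensity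
      (fun z => ENNReal.ofReal (Real.exp (φ z.1)) * ENNReal.ofReal (Real.exp (ψ z.2))) := by
    rw [← prod_withDensity (f := fun x => ENNReal.ofReal (Real.exp (φ x)))
      (g := fun y => ENNReal.ofReal (Real.exp (ψ y))) (by fun_prop) (by fun_prop), ← eφ, ← eψ, ← hprod, smul_smul,
      ← ENNReal.ofReal_mul (inv_nonneg.2 hmpos.le), inv_mul_cancel₀ hmpos.ne', ENNReal.ofReal_one,
      one_smul]
  calc π = θ.withDensity (fun z => (w z)⁻¹) := by
        rw [hθ, withDensity_inv_same hwm (ae_of_all _ hw0) (ae_of_all _ fun z => (hwtop z).ne)]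
    _ = _ := by
        rw [hθprod, ← withDensity_smul _ (by fun_prop), ← withDensity_mul _ (by fun_prop)
          (by fun_prop)]
        congr 1
        ext z
        simp only [Pi.mul_apply, Pi.smul_apply, smul_eq_mul, hw]
        rw [← ENNReal.ofReal_inv_of_pos (Real.exp_pos _), ← Real.exp_neg, neg_neg,
          ← ENNReal.ofReal_mul (Real.exp_pos _).le, ← ENNReal.ofReal_mul (inv_nonneg.2 hmpos.le),
          ← ENNReal.ofReal_mul (by positivity)]
        congr 1
        rw [show h z + (φ z.1 - Real.log m) + ψ z.2 = -Real.log m + (φ z.1 + ψ z.2) + h z by ring,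
          Real.exp_add, Real.exp_add, Real.exp_neg, Real.exp_log hmpos, Real.exp_add]

end Factorization

/-! ### Concentration of random points of a compact set -/

section Concentration

/-- If random points of a compact set are such that every point of the compact set other than `μ`
is separated from them by a continuous function whose mean square tends to `0`, then these
random points concentrate at `μ`. -/
theorem tendsto_sum_mul_of_forall_ne {X : Type*} [TopologicalSpace X] {ι : ℕ → Type*}
    [∀ N, Fintype (ι N)] {q : ∀ N, ι N → ℝ} (hq0 : ∀ N i, 0 ≤ q N i) (hq1 : ∀ N, ∑ i, q N i = 1)
    {π : ∀ N, ι N → X} {K : Set X} (hK : IsCompact K) (hπ : ∀ N i, π N i ∈ K) {μ : X}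
    (h : ∀ ν ∈ K, ν ≠ μ → ∃ Φ : X → ℝ, Continuous Φ ∧ Φ ν ≠ 0 ∧
      Tendsto (fun N => ∑ i, q N i * Φ (π N i) ^ 2) atTop (𝓝 0))
    {Ψ : X → ℝ} (hΨ : Continuous Ψ) :
    Tendsto (fun N => ∑ i, q N i * Ψ (π N i)) atTop (𝓝 (Ψ μ)) := by
  rw [Metric.tendsto_atTop']
  intro δ hδ
  have hd : Continuous fun ν => |Ψ ν - Ψ μ| := (hΨ.sub continuous_const).abs
  have hBc : IsCompact (K ∩ {ν | δ / 2 ≤ |Ψ ν - Ψ μ|}) :=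
    hK.inter_right (isClosed_le continuous_const hd)
  -- Finitely many squares `Φ ^ 2` cover the bad set by compactness; being nonnegative, they add up
  -- without cancellation.
  obtain ⟨Φ, hΦc, hΦ0, hΦt, hΦpos⟩ : ∃ Φ : X → ℝ, Continuous Φ ∧ (∀ ν, 0 ≤ Φ ν) ∧
      Tendsto (fun N => ∑ i, q N i * Φ (π N i)) atTop (𝓝 0) ∧
      ∀ ν ∈ K ∩ {ν | δ / 2 ≤ |Ψ ν - Ψ μ|}, 0 < Φ ν := by
    refine hBc.induction_on (p := fun s => ∃ Φ : X → ℝ, Continuous Φ ∧ (∀ ν, 0 ≤ Φ ν) ∧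
      Tendsto (fun N => ∑ i, q N i * Φ (π N i)) atTop (𝓝 0) ∧ ∀ ν ∈ s, 0 < Φ ν) ?_ ?_ ?_ ?_
    · exact ⟨fun _ => 0, continuous_const, fun _ => le_rfl, by simp, by simp⟩
    · rintro s t hst ⟨Φ, h1, h2, h3, h4⟩
      exact ⟨Φ, h1, h2, h3, fun ν hν => h4 ν (hst hν)⟩
    · rintro s t ⟨Φ, h1, h2, h3, h4⟩ ⟨Φ', h1', h2', h3', h4'⟩
      refine ⟨fun ν => Φ ν + Φ' ν, h1.add h1', fun ν => add_nonneg (h2 ν) (h2' ν), ?_, ?_⟩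
      · simpa [mul_add, Finset.sum_add_distrib] using h3.add h3'
      · rintro ν (hν | hν)
        · exact add_pos_of_pos_of_nonneg (h4 ν hν) (h2' ν)
        · exact add_pos_of_nonneg_of_pos (h2 ν) (h4' ν hν)
    · rintro ν ⟨hνK, hν⟩
      have hne : ν ≠ μ := by
        rintro rfl
        simp only [Set.mem_ofPred_eq, sub_self, abs_zero] at hν
        linarith
      obtain ⟨Φ, h1, h2, h3⟩ := h ν hνK hne
      refine ⟨{ν' | 0 < Φ ν' ^ 2}, mem_nhdsWithin_of_mem_nhds
        ((isOpen_lt continuous_const (h1.pow 2)).mem_nhds (sq_pos_of_ne_zero h2)),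
        fun ν' => Φ ν' ^ 2, h1.pow 2, fun _ => sq_nonneg _, h3, fun _ hν' => hν'⟩
  obtain ⟨C, hC⟩ : ∃ C, ∀ ν ∈ K, |Ψ ν - Ψ μ| ≤ C := by
    obtain ⟨C, hC⟩ := hK.bddAbove_image hd.continuousOn
    exact ⟨C, fun ν hν => hC ⟨ν, hν, rfl⟩⟩
  obtain ⟨η, hη, hηle⟩ : ∃ η > 0, ∀ ν ∈ K ∩ {ν | δ / 2 ≤ |Ψ ν - Ψ μ|}, η ≤ Φ ν := by
    rcases (K ∩ {ν | δ / 2 ≤ |Ψ ν - Ψ μ|}).eq_empty_or_nonempty with he | hne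
    · exact ⟨1, one_pos, by simp [he]⟩
    · obtain ⟨ν, hν, hmin⟩ := hBc.exists_isMinOn hne hΦc.continuousOn
      exact ⟨Φ ν, hΦpos ν hν, fun ν' hν' => hmin hν'⟩
  -- A Markov-type bound: on the bad set `Φ / η ≥ 1` pays for the crude bound `C`.
  have hle : ∀ ν ∈ K, |Ψ ν - Ψ μ| ≤ δ / 2 + C / η * Φ ν := by
    intro ν hν
    have hC0 : 0 ≤ C := (abs_nonneg _).trans (hC ν hν)
    by_cases hb : δ / 2 ≤ |Ψ ν - Ψ μ|
    · have h1 : C ≤ C / η * Φ ν := by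
        rw [div_mul_eq_mul_div, le_div_iff₀ hη]
        exact mul_le_mul_of_nonneg_left (hηle ν ⟨hν, hb⟩) hC0
      linarith [hC ν hν]
    · have h1 : 0 ≤ C / η * Φ ν := mul_nonneg (div_nonneg hC0 hη.le) (hΦ0 ν)
      linarith [not_le.1 hb]
  have hlim : Tendsto (fun N => δ / 2 + C / η * ∑ i, q N i * Φ (π N i)) atTop (𝓝 (δ / 2)) := by
    simpa using tendsto_const_nhds.add (hΦt.const_mul (C / η))
  obtain ⟨n, hn⟩ := eventually_atTop.1 (hlim.eventually (gt_mem_nhds (half_lt_self hδ)))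
  refine ⟨n, fun N hN => ?_⟩
  rw [Real.dist_eq]
  refine lt_of_le_of_lt ?_ (hn N hN.le)
  calc |∑ i, q N i * Ψ (π N i) - Ψ μ| = |∑ i, q N i * (Ψ (π N i) - Ψ μ)| := by
        simp_rw [mul_sub, Finset.sum_sub_distrib, ← Finset.sum_mul, hq1, one_mul]
    _ ≤ ∑ i, q N i * (δ / 2 + C / η * Φ (π N i)) := by
        refine (Finset.abs_sum_le_sum_abs _ _).trans (Finset.sum_le_sum fun i _ => ?_)
        rw [abs_mul, abs_of_nonneg (hq0 N i)]
        exact mul_le_mul_of_nonneg_left (hle _ (hπ N i)) (hq0 N i)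
    _ = δ / 2 + C / η * ∑ i, q N i * Φ (π N i) := by
        simp_rw [mul_add, Finset.sum_add_distrib, ← Finset.sum_mul, hq1, one_mul, Finset.mul_sum]
        congr 1
        exact Finset.sum_congr rfl fun i _ => by ring

end Concentration

/-! ### Empirical measures of matchings -/

section Matching

variable {E : Type*} [MeasurableSpace E]

/-- The empirical measure `(1 / N) ∑ i, δ_{z i}` of `N ≥ 1` points. -/
def empiricalMeasure {F : Type*} [MeasurableSpace F] {N : ℕ} [NeZero N] (z : Fin N → F) :
    ProbabilityMeasure F :=
  ⟨(N : ENNReal)⁻¹ • ∑ i, Measure.dirac (z i), by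
    constructor
    simp only [Measure.smul_apply, Measure.coe_finsetSum, Finset.sum_apply, measure_univ,
      Finset.sum_const, Finset.card_univ, Fintype.card_fin, nsmul_eq_mul, mul_one, smul_eq_mul]
    exact ENNReal.inv_mul_cancel (by exact_mod_cast NeZero.ne N) (ENNReal.natCast_ne_top N)⟩

theorem integral_empiricalMeasure {F : Type*} [MeasurableSpace F] {N : ℕ}
    [NeZero N] (z : Fin N → F) {f : F → ℝ} (hf : StronglyMeasurable f) :
    ∫ x, f x ∂(empiricalMeasure z : Measure F) = (N : ℝ)⁻¹ * ∑ i, f (z i) := by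
  simp only [empiricalMeasure, ProbabilityMeasure.coe_mk]
  rw [integral_smul_measure, integral_finsetSum_measure]
  · simp [integral_dirac' _ _ hf]
  · intro i _
    exact integrable_dirac' hf (by simp)

/-- The empirical measure `(1 / N) ∑ i, δ_{(x i, y (σ i))}` of a matching. -/
def matchingMeasure {N : ℕ} [NeZero N] (x y : Fin N → E) (σ : Equiv.Perm (Fin N)) :
    ProbabilityMeasure (E × E) :=
  empiricalMeasure fun i => (x i, y (σ i))

theorem integral_matchingMeasure {N : ℕ} [NeZero N] (x y : Fin N → E) (σ : Equiv.Perm (Fin N))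
    {f : E × E → ℝ} (hf : StronglyMeasurable f) :
    ∫ z, f z ∂(matchingMeasure x y σ : Measure (E × E)) =
      (N : ℝ)⁻¹ * ∑ i, f (x i, y (σ i)) :=
  integral_empiricalMeasure _ hf

theorem integral_discreteBridge (c : E → E → ℝ) (ε : ℝ) {N : ℕ} [NeZero N] (x y : Fin N → E)
    {f : E × E → ℝ} (hf : StronglyMeasurable f) {C : ℝ} (hC : ∀ z, ‖f z‖ ≤ C) :
    ∫ z, f z ∂(discreteBridge c ε x y : Measure (E × E)) =
      ∑ σ, gibbsWeight c ε x y σ * ∫ z, f z ∂(matchingMeasure x y σ : Measure (E × E)) := by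
  have hrw : (discreteBridge c ε x y : Measure (E × E)) =
      ∑ σ, ENNReal.ofReal (gibbsWeight c ε x y σ) •
        (matchingMeasure x y σ : Measure (E × E)) := rfl
  rw [hrw, integral_finsetSum_measure]
  · refine Finset.sum_congr rfl fun σ _ => ?_
    rw [integral_smul_measure, ENNReal.toReal_ofReal (gibbsWeight_nonneg c ε x y σ), smul_eq_mul]
  · intro σ _
    exact (Integrable.of_bound hf.aestronglyMeasurable C (ae_of_all _ hC)).smul_measure
      ENNReal.ofReal_ne_top

theorem fst_matchingMeasure {N : ℕ} [NeZero N] (x y : Fin N → E) (σ : Equiv.Perm (Fin N)) :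
    (matchingMeasure x y σ : Measure (E × E)).fst = (empiricalMeasure x : Measure E) := by
  ext s hs
  simp [Measure.fst_apply hs, matchingMeasure, empiricalMeasure,
    Measure.dirac_apply' _ (measurable_fst hs), Measure.dirac_apply' _ hs]
  rfl

/-- A permutation only reorders the sum of Dirac masses, so neither marginal of the random matching
is random. -/
theorem snd_matchingMeasure {N : ℕ} [NeZero N] (x y : Fin N → E) (σ : Equiv.Perm (Fin N)) :
    (matchingMeasure x y σ : Measure (E × E)).snd = (empiricalMeasure y : Measure E) := by
  ext s hs
  simp [Measure.snd_apply hs, matchingMeasure, empiricalMeasure,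
    Measure.dirac_apply' _ (measurable_snd hs), Measure.dirac_apply' _ hs]
  congr 1
  exact Equiv.sum_comp σ fun i => s.indicator (1 : E → ENNReal) (y i)

end Matching

/-! ### Convergence for deterministic data -/

section Deterministic

variable {E : Type*} [MetricSpace E] [SecondCountableTopology E] [MeasurableSpace E] [BorelSpace E]

/-- A convergent sequence together with its limit is compact, and relatively compact families on a
complete separable metric space are tight. -/
theorem isTightMeasureSet_range_of_tendsto [CompleteSpace E] {ρ : ℕ → ProbabilityMeasure E}
    {ρ' : ProbabilityMeasure E} (h : Tendsto ρ atTop (𝓝 ρ')) :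
    IsTightMeasureSet (Set.range fun N => (ρ N : Measure E)) := by
  have hc : IsCompact (closure (insert ρ' (Set.range ρ))) :=
    h.isCompact_insert_range.closure
  refine (isTightMeasureSet_of_isCompact_closure hc).subset ?_
  rintro _ ⟨N, rfl⟩
  exact ⟨ρ N, Or.inr ⟨N, rfl⟩, rfl⟩

/-- All matchings of points whose empirical measures converge belong to one compact set. -/
theorem exists_isCompact_matchingMeasure_mem [CompleteSpace E] {x y : ∀ N : ℕ, Fin (N + 1) → E}
    {ρ₀ ρ₁ : ProbabilityMeasure E}
    (hx : Tendsto (fun N => empiricalMeasure (x N)) atTop (𝓝 ρ₀))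
    (hy : Tendsto (fun N => empiricalMeasure (y N)) atTop (𝓝 ρ₁)) :
    ∃ K : Set (ProbabilityMeasure (E × E)), IsCompact K ∧
      ∀ N σ, matchingMeasure (x N) (y N) σ ∈ K := by
  refine ⟨closure {π | ∃ N σ, matchingMeasure (x N) (y N) σ = π},
    isCompact_closure_of_isTightMeasureSet (IsTightMeasureSet.prodMk ?_ ?_),
    fun N σ => subset_closure ⟨N, σ, rfl⟩⟩
  · refine (isTightMeasureSet_range_of_tendsto hx).subset ?_
    rintro _ ⟨_, ⟨_, ⟨N, σ, rfl⟩, rfl⟩, rfl⟩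
    exact ⟨N, (fst_matchingMeasure _ _ σ).symm⟩
  · refine (isTightMeasureSet_range_of_tendsto hy).subset ?_
    rintro _ ⟨_, ⟨_, ⟨N, σ, rfl⟩, rfl⟩, rfl⟩
    exact ⟨N, (snd_matchingMeasure _ _ σ).symm⟩

theorem continuous_integral_of_bounded {F : E × E → ℝ} (hF : Continuous F) {C : ℝ}
    (hC : ∀ z, ‖F z‖ ≤ C) :
    Continuous fun ν : ProbabilityMeasure (E × E) => ∫ z, F z ∂(ν : Measure (E × E)) :=
  ProbabilityMeasure.continuous_integral_boundedContinuousFunction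
    (BoundedContinuousFunction.ofNormedAddCommGroup F hF C hC)

/-- The failure of a measure weighted by `exp (-h)` to factorize on the test functions `f`, `g`. -/
def factorizationDefect (h : E × E → ℝ) (f g : E → ℝ) (π : ProbabilityMeasure (E × E)) : ℝ :=
  (∫ z, Real.exp (-h z) * (f z.1 * g z.2) ∂(π : Measure (E × E))) *
      (∫ z, Real.exp (-h z) ∂(π : Measure (E × E))) -
    (∫ z, Real.exp (-h z) * f z.1 ∂(π : Measure (E × E))) *
      (∫ z, Real.exp (-h z) * g z.2 ∂(π : Measure (E × E)))

/-- As `h ≥ 0`, the weight is at most `1`, so all four integrands are bounded and continuous. -/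
theorem continuous_factorizationDefect {h : E × E → ℝ} (hhc : Continuous h) (h0 : ∀ z, 0 ≤ h z)
    (f g : E →ᵇ ℝ) : Continuous (factorizationDefect h f g) := by
  have hk1 : ∀ z, ‖Real.exp (-h z)‖ ≤ 1 := fun z => by
    rw [Real.norm_of_nonneg (Real.exp_pos _).le]
    exact Real.exp_le_one_iff.2 (neg_nonpos.2 (h0 z))
  have hkc : Continuous fun z => Real.exp (-h z) := hhc.neg.rexp
  have bound : ∀ (F : E × E → ℝ) (C : ℝ), (∀ z, ‖F z‖ ≤ C) →
      ∀ z, ‖Real.exp (-h z) * F z‖ ≤ C := fun F C hF z => by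
    rw [norm_mul]
    exact (mul_le_mul (hk1 z) (hF z) (norm_nonneg _) zero_le_one).trans_eq (one_mul C)
  have cf : Continuous fun z : E × E => f z.1 := f.continuous.comp continuous_fst
  have cg : Continuous fun z : E × E => g z.2 := g.continuous.comp continuous_snd
  have bfg : ∀ z : E × E, ‖f z.1 * g z.2‖ ≤ ‖f‖ * ‖g‖ := fun z => by
    rw [norm_mul]
    exact mul_le_mul (f.norm_coe_le_norm _) (g.norm_coe_le_norm _) (norm_nonneg _) (norm_nonneg _)
  exact ((continuous_integral_of_bounded (hkc.mul (cf.mul cg)) (bound _ _ bfg)).mul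
      (continuous_integral_of_bounded hkc hk1)).sub
    ((continuous_integral_of_bounded (hkc.mul cf) (bound _ _ fun z => f.norm_coe_le_norm _)).mul
      (continuous_integral_of_bounded (hkc.mul cg) (bound _ _ fun z => g.norm_coe_le_norm _)))

/-- The defect of factorization, over the pairs of a matching weighted by `exp (-h)`, tends to `0`
in mean square. -/
theorem tendsto_sum_gibbsWeight_mul_defect_sq {c : E → E → ℝ} {ε : ℝ} {u v : E → ℝ} {h : E × E → ℝ}
    (hh : ∀ z, h z = (u z.1 + v z.2 - c z.1 z.2) / ε) (hhc : Continuous h) (h0 : ∀ z, 0 ≤ h z)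
    (x y : ∀ N : ℕ, Fin (N + 1) → E) (f g : E →ᵇ ℝ) :
    Tendsto (fun N => ∑ σ, gibbsWeight c ε (x N) (y N) σ *
      factorizationDefect h f g (matchingMeasure (x N) (y N) σ) ^ 2) atTop (𝓝 0) := by
  have hk1 : ∀ z, |Real.exp (-h z)| ≤ 1 := fun z => by
    rw [abs_of_pos (Real.exp_pos _)]
    exact Real.exp_le_one_iff.2 (neg_nonpos.2 (h0 z))
  have hkc : Continuous fun z => Real.exp (-h z) := hhc.neg.rexp
  -- One constant that dominates the weighted test functions `1`, `f`, `g` and `f g` at once.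
  set B : ℝ := (1 + ‖f‖) * (1 + ‖g‖) with hB
  have hBprod : ∀ r s t : ℝ, |r| ≤ 1 → |s| ≤ 1 + ‖f‖ → |t| ≤ 1 + ‖g‖ → |r * (s * t)| ≤ B := by
    intro r s t hr hs ht
    calc |r * (s * t)| = |r| * (|s| * |t|) := by rw [abs_mul, abs_mul]
      _ ≤ 1 * ((1 + ‖f‖) * (1 + ‖g‖)) := by gcongr
      _ = B := one_mul _
  have hfb : ∀ s, |f s| ≤ 1 + ‖f‖ := fun s => by
    have := f.norm_coe_le_norm s
    rw [Real.norm_eq_abs] at this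
    linarith
  have hgb : ∀ s, |g s| ≤ 1 + ‖g‖ := fun s => by
    have := g.norm_coe_le_norm s
    rw [Real.norm_eq_abs] at this
    linarith
  have h1f : |(1 : ℝ)| ≤ 1 + ‖f‖ := by simp
  have h1g : |(1 : ℝ)| ≤ 1 + ‖g‖ := by simp
  have b0 : ∀ z, |Real.exp (-h z)| ≤ B := fun z => by
    simpa using hBprod _ 1 1 (hk1 z) h1f h1g
  have bf : ∀ z : E × E, |Real.exp (-h z) * f z.1| ≤ B := fun z => by
    simpa using hBprod _ _ 1 (hk1 z) (hfb z.1) h1g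
  have bg : ∀ z : E × E, |Real.exp (-h z) * g z.2| ≤ B := fun z => by
    simpa using hBprod _ 1 _ (hk1 z) h1f (hgb z.2)
  have bfg : ∀ z : E × E, |Real.exp (-h z) * (f z.1 * g z.2)| ≤ B := fun z =>
    hBprod _ _ _ (hk1 z) (hfb z.1) (hgb z.2)
  have cf : Continuous fun z : E × E => Real.exp (-h z) * f z.1 :=
    hkc.mul (f.continuous.comp continuous_fst)
  have cg : Continuous fun z : E × E => Real.exp (-h z) * g z.2 :=
    hkc.mul (g.continuous.comp continuous_snd)
  have cfg : Continuous fun z : E × E => Real.exp (-h z) * (f z.1 * g z.2) :=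
    hkc.mul ((f.continuous.comp continuous_fst).mul (g.continuous.comp continuous_snd))
  have hcov : ∀ N σ, factorizationDefect h f g (matchingMeasure (x N) (y N) σ) =
      ((N + 1 : ℕ) : ℝ)⁻¹ ^ 2 *
        matchingCov (fun s t => Real.exp (-h (s, t))) f g (x N) (y N) σ := by
    intro N σ
    rw [factorizationDefect, integral_matchingMeasure _ _ _ cfg.stronglyMeasurable,
      integral_matchingMeasure _ _ _ hkc.stronglyMeasurable,
      integral_matchingMeasure _ _ _ cf.stronglyMeasurable,
      integral_matchingMeasure _ _ _ cg.stronglyMeasurable]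
    unfold matchingCov matchingSum
    ring
  have hbound : Tendsto (fun N : ℕ => 16 * B ^ 4 * ((N + 1 : ℕ) : ℝ)⁻¹) atTop (𝓝 0) := by
    have := (tendsto_inv_atTop_zero.comp (tendsto_natCast_atTop_atTop (R := ℝ))).comp
      (tendsto_add_atTop_nat 1)
    simpa using this.const_mul (16 * B ^ 4)
  refine squeeze_zero (fun N => Finset.sum_nonneg fun σ _ =>
    mul_nonneg (gibbsWeight_nonneg c ε _ _ σ) (sq_nonneg _)) (fun N => ?_) hbound
  simp_rw [hcov]
  have hle := sum_gibbsWeight_mul_matchingCov_sq_le c ε u v (f := f) (g := g) (B := B)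
    (k := fun s t => Real.exp (-h (s, t))) (fun s t => by simp only [hh]; congr 1; ring)
    (fun s t => b0 (s, t)) (fun s t => bf (s, t)) (fun s t => bg (s, t))
    (fun s t => bfg (s, t)) (x N) (y N)
  have hN : ((N + 1 : ℕ) : ℝ) ≠ 0 := by positivity
  calc _ = ((N + 1 : ℕ) : ℝ)⁻¹ ^ 4 * ∑ σ, gibbsWeight c ε (x N) (y N) σ *
        matchingCov (fun s t => Real.exp (-h (s, t))) f g (x N) (y N) σ ^ 2 := by
        rw [Finset.mul_sum]
        exact Finset.sum_congr rfl fun σ _ => by ring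
    _ ≤ ((N + 1 : ℕ) : ℝ)⁻¹ ^ 4 * (16 * B ^ 4 * ((N + 1 : ℕ) : ℝ) ^ 3) := by gcongr
    _ = 16 * B ^ 4 * ((N + 1 : ℕ) : ℝ)⁻¹ := by
        field_simp

/-- A coupling which factorizes after weighting by `exp (-(u + v - c) / ε)` is the Schrödinger
bridge of its marginals. -/
theorem IsSchrodingerBridge.eq_of_factorizationDefect_eq_zero {c : E → E → ℝ} {ε : ℝ} {u v : E → ℝ}
    (hu : Measurable u) (hv : Measurable v) {h : E × E → ℝ}
    (hh : ∀ z, h z = (u z.1 + v z.2 - c z.1 z.2) / ε) (hhc : Continuous h) (h0 : ∀ z, 0 ≤ h z)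
    {ρ₀ ρ₁ : Measure E} {a b : E → ℝ} {μ ν : ProbabilityMeasure (E × E)}
    (hμ : IsSchrodingerBridge c ε ρ₀ ρ₁ a b (μ : Measure (E × E)))
    (hfst : (ν : Measure (E × E)).fst = ρ₀) (hsnd : (ν : Measure (E × E)).snd = ρ₁)
    (hprod : ∀ f g : E →ᵇ ℝ, factorizationDefect h f g ν = 0) : ν = μ := by
  obtain ⟨φ, ψ, hφ, hψ, hνd⟩ := exists_eq_withDensity_of_integral_mul_eq _ hhc h0
    fun f g => sub_eq_zero.1 (hprod f g)
  rw [hfst, hsnd] at hνd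
  -- `h` already contains `-c / ε`, so `a` and `b` are merely shifted by `u` and `v`.
  have hμd : (μ : Measure (E × E)) = (ρ₀.prod ρ₁).withDensity (fun z => ENNReal.ofReal
      (Real.exp (h z + (a z.1 - u z.1) / ε + (b z.2 - v z.2) / ε))) := by
    rw [hμ.eq_withDensity]
    congr 1
    ext z
    rw [hh]
    congr 2
    ring
  exact ProbabilityMeasure.toMeasure_injective <|
    eq_of_withDensity_exp_add (φ₂ := fun s => (a s - u s) / ε) (ψ₂ := fun t => (b t - v t) / ε)
      hhc.measurable hφ ((hμ.measurable_left.sub hu).div_const ε) hψ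
      ((hμ.measurable_right.sub hv).div_const ε) hνd hμd
      (hfst.trans hμ.fst_eq.symm) (hsnd.trans hμ.snd_eq.symm)

theorem continuous_sub_integral_comp {p : E × E → E} (hp : Continuous p) (f : E →ᵇ ℝ) (r : ℝ) :
    Continuous fun π : ProbabilityMeasure (E × E) =>
      ∫ s, f s ∂(π : Measure (E × E)).map p - r := by
  simp_rw [integral_map hp.measurable.aemeasurable f.continuous.aestronglyMeasurable]
  exact (continuous_integral_of_bounded (f.continuous.comp hp)
    fun z => f.norm_coe_le_norm (p z)).sub continuous_const

/-- If a marginal of the matchings is deterministic and converges weakly, then it converges in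
mean square on test functions. -/
theorem tendsto_sum_gibbsWeight_mul_marginal_sq {F : Type*} [TopologicalSpace F]
    [MeasurableSpace F] [OpensMeasurableSpace F] (c : F → F → ℝ) (ε : ℝ)
    (x y : ∀ N : ℕ, Fin (N + 1) → F) (p : F × F → F) {ρN : ℕ → ProbabilityMeasure F}
    {ρ : ProbabilityMeasure F} (hlim : Tendsto ρN atTop (𝓝 ρ))
    (hmap : ∀ N σ, (matchingMeasure (x N) (y N) σ : Measure (F × F)).map p = ρN N) (f : F →ᵇ ℝ) :
    Tendsto (fun N => ∑ σ, gibbsWeight c ε (x N) (y N) σ *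
      (∫ s, f s ∂(matchingMeasure (x N) (y N) σ : Measure (F × F)).map p -
        ∫ s, f s ∂(ρ : Measure F)) ^ 2) atTop (𝓝 0) := by
  have hlim' := ((ProbabilityMeasure.tendsto_iff_forall_integral_tendsto.1 hlim f).sub_const
    (∫ s, f s ∂(ρ : Measure F))).pow 2
  rw [sub_self, zero_pow two_ne_zero] at hlim'
  refine hlim'.congr fun N => ?_
  simp_rw [hmap, ← Finset.sum_mul, sum_gibbsWeight, one_mul]

/-- If the empirical measures of the points `x` and `y` converge weakly to `ρ₀` and `ρ₁`, then
the discrete Schrödinger bridges converge weakly to the Schrödinger bridge of `ρ₀` and `ρ₁`. -/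
theorem tendsto_discreteBridge [CompleteSpace E] {c : E → E → ℝ} (hc : Continuous (Function.uncurry c))
    {u v : E → ℝ} (hu : Continuous u) (hv : Continuous v) (hcuv : ∀ s t, c s t ≤ u s + v t)
    {ε : ℝ} (hε : 0 < ε) {ρ₀ ρ₁ : ProbabilityMeasure E} {a b : E → ℝ}
    {μ : ProbabilityMeasure (E × E)}
    (hμ : IsSchrodingerBridge c ε (ρ₀ : Measure E) (ρ₁ : Measure E) a b (μ : Measure (E × E)))
    {x y : ∀ N : ℕ, Fin (N + 1) → E}
    (hx : Tendsto (fun N => empiricalMeasure (x N)) atTop (𝓝 ρ₀))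
    (hy : Tendsto (fun N => empiricalMeasure (y N)) atTop (𝓝 ρ₁)) :
    Tendsto (fun N => discreteBridge c ε (x N) (y N)) atTop (𝓝 μ) := by
  obtain ⟨K, hK, hKmem⟩ := exists_isCompact_matchingMeasure_mem hx hy
  set h : E × E → ℝ := fun z => (u z.1 + v z.2 - c z.1 z.2) / ε with hh
  have hhc : Continuous h :=
    (((hu.comp continuous_fst).add (hv.comp continuous_snd)).sub hc).div_const ε
  have h0 : ∀ z, 0 ≤ h z := fun z => div_nonneg (sub_nonneg.2 (hcuv _ _)) hε.le
  rw [ProbabilityMeasure.tendsto_iff_forall_integral_tendsto]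
  intro Ψ
  have hrw : ∀ N, ∫ z, Ψ z ∂(discreteBridge c ε (x N) (y N) : Measure (E × E)) =
      ∑ σ, gibbsWeight c ε (x N) (y N) σ *
        ∫ z, Ψ z ∂(matchingMeasure (x N) (y N) σ : Measure (E × E)) := fun N =>
    integral_discreteBridge c ε _ _ Ψ.continuous.stronglyMeasurable Ψ.norm_coe_le_norm
  simp_rw [hrw]
  refine tendsto_sum_mul_of_forall_ne (ι := fun N => Equiv.Perm (Fin (N + 1)))
    (q := fun N => gibbsWeight c ε (x N) (y N)) (π := fun N => matchingMeasure (x N) (y N))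
    (Ψ := fun ν : ProbabilityMeasure (E × E) => ∫ z, Ψ z ∂(ν : Measure (E × E))) (fun N σ => gibbsWeight_nonneg c ε _ _ σ)
    (fun N => sum_gibbsWeight c ε _ _) hK hKmem ?_
    (ProbabilityMeasure.continuous_integral_boundedContinuousFunction Ψ)
  intro ν _ hν
  by_contra hcon
  push Not at hcon
  -- `hcon` now says that a continuous function with vanishing mean square vanishes at `ν`. It is
  -- applied to the marginal errors and to the factorization defects.
  have hmarg : ∀ (p : E × E → E) (_ : Continuous p) (ρN : ℕ → ProbabilityMeasure E)
      (ρ : ProbabilityMeasure E), Tendsto ρN atTop (𝓝 ρ) →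
      (∀ N σ, (matchingMeasure (x N) (y N) σ : Measure (E × E)).map p = ρN N) →
      (ν : Measure (E × E)).map p = ρ := by
    intro p hp ρN ρ hlim hmap
    have := Measure.isProbabilityMeasure_map (μ := (ν : Measure (E × E)))
      hp.measurable.aemeasurable
    refine ext_of_forall_integral_eq_of_IsFiniteMeasure fun f => ?_
    by_contra hne
    exact hcon _ (continuous_sub_integral_comp hp f (∫ s, f s ∂(ρ : Measure E)))
      (sub_ne_zero.2 hne) (tendsto_sum_gibbsWeight_mul_marginal_sq c ε x y p hlim hmap f)
  refine hν (hμ.eq_of_factorizationDefect_eq_zero hu.measurable hv.measurable (fun _ => rfl) hhc h0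
    (hmarg Prod.fst continuous_fst _ _ hx fun N σ => fst_matchingMeasure _ _ σ)
    (hmarg Prod.snd continuous_snd _ _ hy fun N σ => snd_matchingMeasure _ _ σ) fun f g => ?_)
  by_contra hne
  exact hcon _ (continuous_factorizationDefect hhc h0 f g) hne
    (tendsto_sum_gibbsWeight_mul_defect_sq (fun _ => rfl) hhc h0 x y f g)

end Deterministic

/-! ### Random data -/

section Empirical

/-- Varadarajan's theorem: the empirical measures of an i.i.d. sequence converge weakly to its
common law almost surely. -/
theorem ae_tendsto_empiricalMeasure {F : Type*} [TopologicalSpace F] [SecondCountableTopology F]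
    [MeasurableSpace F] [OpensMeasurableSpace F] (ν : ProbabilityMeasure F) :
    ∀ᵐ ω ∂(Measure.infinitePi fun _ : ℕ => (ν : Measure F)),
      Tendsto (fun N : ℕ => empiricalMeasure fun i : Fin (N + 1) => ω i) atTop (𝓝 ν) := by
  have hlln : ∀ s : Set F, MeasurableSet s →
      ∀ᵐ ω ∂(Measure.infinitePi fun _ : ℕ => (ν : Measure F)),
        Tendsto (fun N : ℕ => (empiricalMeasure fun i : Fin (N + 1) => ω i) s)
          atTop (𝓝 (ν s)) := by
    intro s hs
    have hm : Measurable (s.indicator (1 : F → ℝ)) := measurable_one.indicator hs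
    have hind := ProbabilityTheory.iIndepFun_infinitePi (P := fun _ : ℕ => (ν : Measure F))
      (X := fun _ => s.indicator (1 : F → ℝ)) fun _ => hm
    have hid : ∀ i : ℕ, ProbabilityTheory.IdentDistrib
        (fun ω : ℕ → F => s.indicator (1 : F → ℝ) (ω i)) (fun ω => s.indicator (1 : F → ℝ) (ω 0))
        (Measure.infinitePi fun _ : ℕ => (ν : Measure F))
        (Measure.infinitePi fun _ : ℕ => (ν : Measure F)) := by
      intro i
      have : ProbabilityTheory.IdentDistrib (fun ω : ℕ → F => ω i) (fun ω => ω 0)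
          (Measure.infinitePi fun _ : ℕ => (ν : Measure F))
          (Measure.infinitePi fun _ : ℕ => (ν : Measure F)) :=
        ⟨(measurable_pi_apply i).aemeasurable, (measurable_pi_apply 0).aemeasurable, by
          rw [Measure.infinitePi_map_eval, Measure.infinitePi_map_eval]⟩
      exact this.comp hm
    have hint : Integrable (fun ω : ℕ → F => s.indicator (1 : F → ℝ) (ω 0))
        (Measure.infinitePi fun _ : ℕ => (ν : Measure F)) := by
      refine Integrable.of_bound (hm.comp (measurable_pi_apply 0)).aestronglyMeasurable 1
        (ae_of_all _ fun ω => ?_)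
      by_cases h : ω 0 ∈ s <;> simp [h]
    have hE : ∫ ω : ℕ → F, s.indicator (1 : F → ℝ) (ω 0)
        ∂(Measure.infinitePi fun _ : ℕ => (ν : Measure F)) = (ν : Measure F).real s := by
      rw [← integral_indicator_one hs]
      conv_rhs => rw [← Measure.infinitePi_map_eval (fun _ : ℕ => (ν : Measure F)) 0]
      exact (integral_map (measurable_pi_apply 0).aemeasurable hm.aestronglyMeasurable).symm
    filter_upwards [ProbabilityTheory.strong_law_ae_real
      (fun (i : ℕ) (ω : ℕ → F) => s.indicator (1 : F → ℝ) (ω i)) hint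
      (fun i j hij => hind.indepFun hij) hid] with ω hω
    rw [hE] at hω
    rw [← NNReal.tendsto_coe]
    refine (hω.comp (tendsto_add_atTop_nat 1)).congr fun N => ?_
    have hI := integral_empiricalMeasure (fun i : Fin (N + 1) => ω i) hm.stronglyMeasurable
    rw [integral_indicator_one hs] at hI
    rw [← ProbabilityMeasure.measureReal_eq_coe_coeFn, hI, Function.comp_apply,
      Finset.sum_range, div_eq_inv_mul]
  -- A countable π-system of open sets containing a basis: countability lets the exceptional null
  -- sets be combined.
  set S : Set (Set F) := {s | ∃ T : Set (Set F), T ⊆ TopologicalSpace.countableBasis F ∧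
    T.Finite ∧ s = ⋂₀ T} with hS
  have hScount : S.Countable := by
    have := Set.countable_ofPred_finite_subset (TopologicalSpace.countable_countableBasis F)
    refine (this.image Set.sInter).mono ?_
    rintro s ⟨T, h1, h2, rfl⟩
    exact ⟨T, ⟨h2, h1⟩, rfl⟩
  have hSopen : ∀ s ∈ S, IsOpen s := by
    rintro s ⟨T, h1, h2, rfl⟩
    exact h2.isOpen_sInter fun t ht => TopologicalSpace.isOpen_of_mem_countableBasis (h1 ht)
  have hSpi : IsPiSystem S := by
    rintro _ ⟨T, h1, h2, rfl⟩ _ ⟨T', h1', h2', rfl⟩ _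
    exact ⟨T ∪ T', Set.union_subset h1 h1', h2.union h2', by rw [Set.sInter_union]⟩
  filter_upwards [(ae_ball_iff hScount).2 fun s hs => hlln s (hSopen s hs).measurableSet] with ω hω
  refine hSpi.tendsto_probabilityMeasure_of_tendsto_of_mem (fun s hs => (hSopen s hs).measurableSet)
    ?_ hω
  intro U hU z hz
  obtain ⟨V, hV, hzV, hVU⟩ :=
    (TopologicalSpace.isBasis_countableBasis F).exists_subset_of_mem_open hz hU
  have hVS : V ∈ S := ⟨{V}, by simpa using hV, Set.finite_singleton V, by simp⟩
  exact ⟨V, hVS, (hSopen V hVS).mem_nhds hzV, hVU⟩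

variable {E : Type*} [MetricSpace E] [SecondCountableTopology E] [MeasurableSpace E] [BorelSpace E]

/-- The discrete Schrödinger bridge depends continuously on the data. -/
theorem continuous_empiricalBridge {c : E → E → ℝ} (hc : Continuous (Function.uncurry c)) (ε : ℝ)
    (N : ℕ) [NeZero N] : Continuous (empiricalBridge c ε N) := by
  rw [ProbabilityMeasure.continuous_iff_forall_continuous_integral]
  intro f
  have hrw : (fun ω : ℕ → E × E => ∫ z, f z ∂(empiricalBridge c ε N ω : Measure (E × E))) =
      fun ω => ∑ σ : Equiv.Perm (Fin N),
        gibbsWeight c ε (fun i : Fin N => (ω i).1) (fun i : Fin N => (ω i).2) σ *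
          ((N : ℝ)⁻¹ * ∑ i : Fin N, f ((ω (i : ℕ)).1, (ω (σ i : ℕ)).2)) := by
    ext ω
    unfold empiricalBridge
    rw [integral_discreteBridge c ε _ _ f.continuous.stronglyMeasurable f.norm_coe_le_norm]
    simp_rw [integral_matchingMeasure _ _ _ f.continuous.stronglyMeasurable]
  rw [hrw]
  have hpair : ∀ i j : ℕ, Continuous fun ω : ℕ → E × E => ((ω i).1, (ω j).2) := fun i j => by
    fun_prop
  have hcost : ∀ σ : Equiv.Perm (Fin N), Continuous fun ω : ℕ → E × E =>
      Real.exp (-(1 / ε) *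
        matchingCost c (fun i : Fin N => (ω i).1) (fun i : Fin N => (ω i).2) σ) := fun σ =>
    (continuous_const.mul (continuous_finsetSum _ fun (i : Fin N) _ => hc.comp (hpair i (σ i)))).rexp
  refine continuous_finsetSum _ fun σ _ => Continuous.mul ?_ ?_
  · exact (hcost σ).div (continuous_finsetSum _ fun τ _ => hcost τ) fun ω =>
      (Finset.sum_pos (fun _ _ => Real.exp_pos _) Finset.univ_nonempty).ne'
  · exact continuous_const.mul
      (continuous_finsetSum _ fun (i : Fin N) _ => f.continuous.comp (hpair i (σ i)))

/-- For data i.i.d. from any coupling of `ρ₀` and `ρ₁`, the discrete Schrödinger bridges converge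
weakly to the Schrödinger bridge of `ρ₀` and `ρ₁` almost surely. -/
theorem ae_tendsto_empiricalBridge [CompleteSpace E] {c : E → E → ℝ} (hc : Continuous (Function.uncurry c))
    {u v : E → ℝ} (hu : Continuous u) (hv : Continuous v) (hcuv : ∀ s t, c s t ≤ u s + v t)
    {ε : ℝ} (hε : 0 < ε) {ρ₀ ρ₁ : Measure E} {a b : E → ℝ} {μ : ProbabilityMeasure (E × E)}
    (hμ : IsSchrodingerBridge c ε ρ₀ ρ₁ a b (μ : Measure (E × E)))
    (ν : Measure (E × E)) [IsProbabilityMeasure ν] (hν₀ : ν.fst = ρ₀) (hν₁ : ν.snd = ρ₁) :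
    ∀ᵐ ω ∂(Measure.infinitePi fun _ : ℕ => ν),
      Tendsto (fun N : ℕ => empiricalBridge c ε (N + 1) ω) atTop (𝓝 μ) := by
  subst hν₀ hν₁
  filter_upwards [ae_tendsto_empiricalMeasure ⟨ν, inferInstance⟩] with ω hω
  refine tendsto_discreteBridge (ρ₀ := ⟨ν.fst, inferInstance⟩) (ρ₁ := ⟨ν.snd, inferInstance⟩)
    hc hu hv hcuv hε hμ ?_ ?_
  · refine (ProbabilityMeasure.tendsto_map_of_tendsto_of_continuous _ _ hω
      continuous_fst).congr fun N => ?_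
    -- The matching by the identity permutation is the empirical measure of the pairs themselves.
    exact Subtype.ext
      (fst_matchingMeasure (fun i : Fin (N + 1) => (ω i).1) (fun i => (ω i).2) 1)
  · refine (ProbabilityMeasure.tendsto_map_of_tendsto_of_continuous _ _ hω
      continuous_snd).congr fun N => ?_
    exact Subtype.ext
      (snd_matchingMeasure (fun i : Fin (N + 1) => (ω i).1) (fun i => (ω i).2) 1)

theorem tendsto_measure_empiricalBridge_notMem {c : E → E → ℝ}
    (hc : Continuous (Function.uncurry c)) {ε : ℝ} {μ : ProbabilityMeasure (E × E)}
    {P : Measure (ℕ → E × E)} [IsFiniteMeasure P]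
    (h : ∀ᵐ ω ∂P, Tendsto (fun N : ℕ => empiricalBridge c ε (N + 1) ω) atTop (𝓝 μ))
    {U : Set (ProbabilityMeasure (E × E))} (hU : U ∈ 𝓝 μ) :
    Tendsto (fun N : ℕ => P {ω | empiricalBridge c ε (N + 1) ω ∉ U}) atTop (𝓝 0) := by
  -- `U` need not be measurable; for the open `V`, continuity in the data makes the events
  -- measurable.
  obtain ⟨V, hVU, hV, hμV⟩ := mem_nhds_iff.1 hU
  have hmeas : ∀ N : ℕ, MeasurableSet {ω | empiricalBridge c ε (N + 1) ω ∈ Vᶜ} := fun N =>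
    (hV.isClosed_compl.preimage (continuous_empiricalBridge hc ε (N + 1))).measurableSet
  have hlim : Tendsto (fun N : ℕ => P {ω | empiricalBridge c ε (N + 1) ω ∈ Vᶜ}) atTop
      (𝓝 (P ∅)) := by
    refine tendsto_measure_of_ae_tendsto_indicator_of_isFiniteMeasure atTop MeasurableSet.empty
      hmeas ?_
    filter_upwards [h] with ω hω
    filter_upwards [hω.eventually (hV.mem_nhds hμV)] with N hN
    exact iff_of_false (fun h' => h' hN) (Set.notMem_empty ω)
  rw [measure_empty] at hlim
  exact tendsto_of_tendsto_of_tendsto_of_le_of_le tendsto_const_nhds hlim (fun _ => zero_le)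
    fun N => measure_mono fun ω hω hω' => hω (hVU hω')

end Empirical

/-- A continuous function bounded by `A + B (‖x‖ ^ p + ‖y‖ ^ p)` outside a compact set satisfies
such a bound everywhere. -/
theorem exists_le_add_mul_rpow {E : Type*} [NormedAddCommGroup E] {c : E → E → ℝ}
    (hc : Continuous (Function.uncurry c)) {A B p : ℝ} (hB : 0 ≤ B)
    (h : ∀ᶠ z : E × E in cocompact _, c z.1 z.2 ≤ A + B * (‖z.1‖ ^ p + ‖z.2‖ ^ p)) :
    ∃ A', ∀ s t, c s t ≤ (A' + B * ‖s‖ ^ p) + B * ‖t‖ ^ p := by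
  obtain ⟨K, hK, hKc⟩ := mem_cocompact.1 h
  obtain ⟨C, hC⟩ := hK.bddAbove_image hc.continuousOn
  refine ⟨max A C, fun s t => ?_⟩
  by_cases hst : (s, t) ∈ K
  · have h1 : c s t ≤ C := hC ⟨(s, t), hst, rfl⟩
    have h2 : 0 ≤ B * ‖s‖ ^ p := by positivity
    have h3 : 0 ≤ B * ‖t‖ ^ p := by positivity
    linarith [le_max_right A C]
  · have h1 : c s t ≤ A + B * (‖s‖ ^ p + ‖t‖ ^ p) := hKc hst
    linarith [le_max_left A C]

end SchrodingerBridge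

end

theorem theorem12 {d : ℕ}
    -- two probability densities on `ℝ^d`
    (ρ₀ ρ₁ : Measure (EuclideanSpace ℝ (Fin d)))
    [IsProbabilityMeasure ρ₀] [IsProbabilityMeasure ρ₁]
    (hρ₀ : ρ₀ ≪ volume) (hρ₁ : ρ₁ ≪ volume)
    -- the cost and its growth
    (c : EuclideanSpace ℝ (Fin d) → EuclideanSpace ℝ (Fin d) → ℝ)
    (hc_cont : Continuous (Function.uncurry c))
    (hc_nonneg : ∀ x y, 0 ≤ c x y)
    (hc_zero : ∀ x y, c x y = 0 ↔ x = y)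
    (p : ℝ) (hp : 1 ≤ p)
    (hc_growth : ∃ A > 0, ∃ B > 0,
      ∀ᶠ z : EuclideanSpace ℝ (Fin d) × EuclideanSpace ℝ (Fin d) in Filter.cocompact _,
        c z.1 z.2 ≤ A + B * (‖z.1‖ ^ p + ‖z.2‖ ^ p))
    -- finite `p`-th moments
    (hmom₀ : Integrable (fun x => ‖x‖ ^ p) ρ₀)
    (hmom₁ : Integrable (fun y => ‖y‖ ^ p) ρ₁)
    -- the static Schrödinger bridge at temperature `ε`, with integrable potentials
    (ε : ℝ) (hε : 0 < ε)
    (a b : EuclideanSpace ℝ (Fin d) → ℝ)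
    (μ : ProbabilityMeasure (EuclideanSpace ℝ (Fin d) × EuclideanSpace ℝ (Fin d)))
    (hμ : SchrodingerBridge.IsSchrodingerBridge c ε ρ₀ ρ₁ a b (μ : Measure _))
    (ha : Integrable a ρ₀) (hb : Integrable b ρ₁) :
    -- almost sure weak convergence for data i.i.d. from the Schrödinger bridge
    (∀ᵐ ω ∂(Measure.infinitePi fun _ : ℕ =>
        (μ : Measure (EuclideanSpace ℝ (Fin d) × EuclideanSpace ℝ (Fin d)))),
      Tendsto (fun N : ℕ => SchrodingerBridge.empiricalBridge c ε (N + 1) ω) atTop (𝓝 μ)) ∧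
    -- weak convergence in probability for data i.i.d. from the product measure
    (∀ U ∈ 𝓝 μ,
      Tendsto (fun N : ℕ => (Measure.infinitePi fun _ : ℕ => ρ₀.prod ρ₁)
        {ω | SchrodingerBridge.empiricalBridge c ε (N + 1) ω ∉ U}) atTop (𝓝 0)) := by
  obtain ⟨A, _, B, hB, hgrowth⟩ := hc_growth
  obtain ⟨A', hA'⟩ := SchrodingerBridge.exists_le_add_mul_rpow hc_cont hB.le hgrowth
  have hpow : Continuous fun x : EuclideanSpace ℝ (Fin d) => ‖x‖ ^ p :=
    continuous_norm.rpow_const fun _ => Or.inr (zero_le_one.trans hp)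
  -- The growth bound gives `c ≤ u + v` with `u = A' + B ‖x‖ ^ p` and `v = B ‖y‖ ^ p`.
  have hae := fun (ν : Measure (EuclideanSpace ℝ (Fin d) × EuclideanSpace ℝ (Fin d)))
      [IsProbabilityMeasure ν] => SchrodingerBridge.ae_tendsto_empiricalBridge hc_cont
    (continuous_const.add (continuous_const.mul hpow)) (continuous_const.mul hpow) hA' hε hμ ν
  exact ⟨hae μ hμ.fst_eq hμ.snd_eq, fun U hU =>
    SchrodingerBridge.tendsto_measure_empiricalBridge_notMem hc_cont
      (hae (ρ₀.prod ρ₁) Measure.fst_prod Measure.snd_prod) hU⟩
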